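/- Let $d,n\in\mathbb{N}$ with $n>d\ge 1$, and let $X_1,\dots,X_n$ be independent random variables, each uniformly distributed on $[0,1]^d$. For points $x_1,\dots,x_n\in[0,1]^d$ define the dispersion $$\operatorname{disp}(x_1,\dots,x_n):=\sup\{\lambda_d(B) : B=I_1\times\dots\times I_d,\ I_k\subseteq[0,1]\text{ intervals},\ B\cap\{x_1,\dots,x_n\}=\emptyset\},$$ where $\lambda_d$ is the $d$-dimensional Lebesgue measure. Then $$\max\left\{\frac{\log n}{9n},\ \frac{d}{2\mathrm{e}\,n}\right\}\ \le\ \mathbb{E}\bigl(\operatorname{disp}(X_1,\dots,X_n)\bigr)\ \le\ \frac{9d}{n}\,\log\left(\frac{\mathrm{e}\,n}{d}\right),$$ where $\log$ is the natural logarithm. -/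

import Mathlib

/-- An axis-parallel box `I₁ × ⋯ × I_d` inside the unit cube, with arbitrary intervals
`I_k ⊆ [0,1]` (open, closed, half-open or degenerate). -/
def IsAxisBox {d : ℕ} (B : Set (Fin d → ℝ)) : Prop :=
  ∃ I : Fin d → Set ℝ,
    (∀ k, (I k).OrdConnected ∧ I k ⊆ Set.Icc (0 : ℝ) 1) ∧ B = Set.univ.pi I

/-- The dispersion of `x₁, …, x_n`: the supremum of the Lebesgue measures of the
axis-parallel boxes in `[0,1]^d` that contain none of the points. -/
noncomputable def dispersion {d n : ℕ} (x : Fin n → Fin d → ℝ) : ℝ :=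
  sSup {v : ℝ | ∃ B : Set (Fin d → ℝ), IsAxisBox B ∧ B ∩ Set.range x = ∅ ∧
    v = (MeasureTheory.volume B).toReal}

open MeasureTheory Set

/-! Upper bound: symmetrization with a ghost sample. If a box `B` misses all of `x`, an independent
sample `y` satisfies E ∏ (1 + 1_B(y_i)) = (1 + λ(B))^n, so (1 + disp x)^n is at most the
`y`-expectation of a supremum of products of pair weights. Swapping `x_i` with `y_i` preserves the
joint law. Averaged over all swaps, each trace of a box on the 2n points contributes at most 1, so E
(1 + disp)^n is at most the number of traces. Boxes have VC dimension at most 2d, and Sauer–Shelah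
bounds this number by (en/d)^(2d). Jensen and a logarithm finish
(`integral_one_add_dispersion_pow_le`, `integral_dispersion_le`).

Lower bound d/(2en): shrink [0,r)^d once per point, along that point's largest coordinate. The
resulting empty box has as volume r^d times a product of i.i.d. factors, so its mean is explicit and
r can be optimized (`integral_dispersion_ge_dim`).

Lower bound log n/(9n): cut the cube into about 2n/log n parallel slabs. The expected number of
missed slabs is at least 1, and the second moment method shows that some slab is missed with
probability at least 1/2 (`integral_dispersion_ge_log`). -/

/-- The unit cube `[0,1]^d`. -/
def unitCube (d : ℕ) : Set (Fin d → ℝ) := univ.pi fun _ => Icc (0 : ℝ) 1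

/-- The uniform distribution on the unit cube. -/
noncomputable def cubeMeasure (d : ℕ) : Measure (Fin d → ℝ) := volume.restrict (unitCube d)

/-- The open box whose corners are given by pairs of rational numbers. -/
def ratBox {d : ℕ} (q : Fin d → ℚ × ℚ) : Set (Fin d → ℝ) :=
  univ.pi fun k => Ioo ((q k).1 : ℝ) (q k).2

/-! ### Boxes in the cube; dispersion as a countable supremum. -/

lemma volume_unitCube (d : ℕ) : volume (unitCube d) = 1 := by
  rw [unitCube, volume_pi_pi]
  simp

lemma measurableSet_unitCube (d : ℕ) : MeasurableSet (unitCube d) :=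
  MeasurableSet.univ_pi fun _ => measurableSet_Icc

instance isProbabilityMeasure_cubeMeasure (d : ℕ) : IsProbabilityMeasure (cubeMeasure d) :=
  ⟨by rw [cubeMeasure, Measure.restrict_apply_univ, volume_unitCube]⟩

lemma measurableSet_ratBox {d : ℕ} (q : Fin d → ℚ × ℚ) : MeasurableSet (ratBox q) :=
  MeasurableSet.univ_pi fun _ => measurableSet_Ioo

lemma IsAxisBox.subset_unitCube {d : ℕ} {B : Set (Fin d → ℝ)} (hB : IsAxisBox B) :
    B ⊆ unitCube d := by
  obtain ⟨I, hI, rfl⟩ := hB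
  exact pi_mono fun k _ => (hI k).2

lemma IsAxisBox.volume_le_one {d : ℕ} {B : Set (Fin d → ℝ)} (hB : IsAxisBox B) :
    volume B ≤ 1 :=
  (measure_mono hB.subset_unitCube).trans (volume_unitCube d).le

lemma isAxisBox_inter_unitCube {d : ℕ} {I : Fin d → Set ℝ} (hI : ∀ k, (I k).OrdConnected) :
    IsAxisBox (univ.pi I ∩ unitCube d) :=
  ⟨fun k => I k ∩ Icc 0 1, fun k => ⟨(hI k).inter ordConnected_Icc, inter_subset_right⟩,
    pi_inter_distrib.symm⟩

lemma bddAbove_emptyBox_volumes {d n : ℕ} (x : Fin n → Fin d → ℝ) :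
    BddAbove {v : ℝ | ∃ B : Set (Fin d → ℝ), IsAxisBox B ∧ B ∩ range x = ∅ ∧
      v = (volume B).toReal} := by
  refine ⟨1, ?_⟩
  rintro v ⟨B, hB, -, rfl⟩
  exact ENNReal.toReal_le_of_le_ofReal zero_le_one (by simpa using hB.volume_le_one)

/-- The volume of the part inside the cube of a box that contains none of the points bounds the
dispersion from below. -/
lemma measureReal_pi_le_dispersion {d n : ℕ} {x : Fin n → Fin d → ℝ} {I : Fin d → Set ℝ}
    (hI : ∀ k, (I k).OrdConnected) (hx : ∀ i, x i ∉ univ.pi I) :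
    (cubeMeasure d).real (univ.pi I) ≤ dispersion x := by
  refine le_csSup (bddAbove_emptyBox_volumes x)
    ⟨_, isAxisBox_inter_unitCube hI, ?_, ?_⟩
  · refine eq_empty_of_forall_notMem ?_
    rintro _ ⟨h, i, rfl⟩
    exact hx i h.1
  · rw [Measure.real, cubeMeasure, Measure.restrict_apply' (measurableSet_unitCube d)]

lemma dispersion_nonneg {d n : ℕ} (x : Fin n → Fin d → ℝ) : 0 ≤ dispersion x :=
  Real.sSup_nonneg (by rintro v ⟨B, -, -, rfl⟩; exact ENNReal.toReal_nonneg)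

lemma dispersion_le_one {d n : ℕ} (x : Fin n → Fin d → ℝ) : dispersion x ≤ 1 := by
  refine Real.sSup_le ?_ zero_le_one
  rintro v ⟨B, hB, -, rfl⟩
  exact ENNReal.toReal_le_of_le_ofReal zero_le_one (by simpa using hB.volume_le_one)

/-- The measure of an axis-parallel box is approximated from inside by rational boxes. -/
lemma IsAxisBox.volume_le_of_ratBox {d : ℕ} {B : Set (Fin d → ℝ)} (hB : IsAxisBox B)
    {c : ENNReal} (hc : ∀ q : Fin d → ℚ × ℚ, ratBox q ⊆ B → cubeMeasure d (ratBox q) ≤ c) :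
    volume B ≤ c := by
  have hBcube := hB.subset_unitCube
  obtain ⟨I, hI, rfl⟩ := hB
  by_cases hne : ∀ k, (I k).Nonempty
  swap
  · push Not at hne
    obtain ⟨k, hk⟩ := hne
    rw [univ_pi_eq_empty hk]
    simp
  have hbb : ∀ k, BddBelow (I k) := fun k => bddBelow_Icc.mono (hI k).2
  have hba : ∀ k, BddAbove (I k) := fun k => bddAbove_Icc.mono (hI k).2
  have hsub : ∀ k, I k ⊆ Icc (sInf (I k)) (sSup (I k)) := fun k x hx =>
    ⟨csInf_le (hbb k) hx, le_csSup (hba k) hx⟩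
  have hsup : ∀ k, Ioo (sInf (I k)) (sSup (I k)) ⊆ I k := by
    rintro k x ⟨h1, h2⟩
    obtain ⟨a, ha, hax⟩ := exists_lt_of_csInf_lt (hne k) h1
    obtain ⟨b, hb, hxb⟩ := exists_lt_of_lt_csSup (hne k) h2
    exact (hI k).1.out ha hb ⟨hax.le, hxb.le⟩
  -- The rational endpoints may cross when a side is short or degenerate. This is harmless: the box
  -- is then empty and `ENNReal.ofReal` truncates the negative length to 0.
  have hp : ∀ (m : ℕ) k, ∃ p : ℚ, sInf (I k) < p ∧ (p : ℝ) < sInf (I k) + 1 / ((m : ℝ) + 1) :=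
    fun m k => exists_rat_btwn (by linarith [Nat.one_div_pos_of_nat (α := ℝ) (n := m)])
  have hq : ∀ (m : ℕ) k, ∃ q : ℚ, sSup (I k) - 1 / ((m : ℝ) + 1) < q ∧ (q : ℝ) < sSup (I k) :=
    fun m k => exists_rat_btwn (by linarith [Nat.one_div_pos_of_nat (α := ℝ) (n := m)])
  choose p hp1 hp2 using hp
  choose q hq1 hq2 using hq
  have hbox : ∀ m, ratBox (fun k => (p m k, q m k)) ⊆ univ.pi I := fun m =>
    pi_mono fun k _ => (Ioo_subset_Ioo (hp1 m k).le (hq2 m k).le).trans (hsup k)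
  have hlim : Filter.Tendsto (fun m => ∏ k, ENNReal.ofReal ((q m k : ℝ) - p m k)) Filter.atTop
      (nhds (∏ k, ENNReal.ofReal (sSup (I k) - sInf (I k)))) := by
    refine ENNReal.tendsto_finsetProd_of_ne_top _ (fun k _ => ?_)
      (fun k _ => ENNReal.ofReal_ne_top)
    refine ENNReal.tendsto_ofReal (Filter.Tendsto.sub ?_ ?_)
    · refine tendsto_of_tendsto_of_tendsto_of_le_of_le ?_ tendsto_const_nhds
        (fun m => (hq1 m k).le) (fun m => (hq2 m k).le)
      simpa using tendsto_const_nhds.sub (tendsto_one_div_add_atTop_nhds_zero_nat (𝕜 := ℝ))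
    · refine tendsto_of_tendsto_of_tendsto_of_le_of_le tendsto_const_nhds ?_
        (fun m => (hp1 m k).le) (fun m => (hp2 m k).le)
      simpa using tendsto_const_nhds.add (tendsto_one_div_add_atTop_nhds_zero_nat (𝕜 := ℝ))
  calc volume (univ.pi I) ≤ volume (univ.pi fun k => Icc (sInf (I k)) (sSup (I k))) :=
        measure_mono (pi_mono fun k _ => hsub k)
    _ = ∏ k, ENNReal.ofReal (sSup (I k) - sInf (I k)) := by
        rw [volume_pi_pi]
        simp
    _ ≤ c := by
        refine le_of_tendsto' hlim fun m => ?_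
        have := hc _ (hbox m)
        rwa [cubeMeasure, Measure.restrict_eq_self _ ((hbox m).trans hBcube), ratBox,
          Real.volume_pi_Ioo] at this

/-- The dispersion is a supremum over countably many boxes. -/
lemma ofReal_dispersion_eq_iSup {d n : ℕ} (x : Fin n → Fin d → ℝ) :
    ENNReal.ofReal (dispersion x) =
      ⨆ q : Fin d → ℚ × ℚ, ⨆ _ : ∀ i, x i ∉ ratBox q, cubeMeasure d (ratBox q) := by
  refine le_antisymm ?_ ?_
  · set c := ⨆ q : Fin d → ℚ × ℚ, ⨆ _ : ∀ i, x i ∉ ratBox q, cubeMeasure d (ratBox q) with hc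
    have hc1 : c ≤ 1 := iSup₂_le fun q _ => prob_le_one
    have hct : c ≠ ⊤ := ne_top_of_le_ne_top ENNReal.one_ne_top hc1
    refine ENNReal.ofReal_le_of_le_toReal (Real.sSup_le ?_ ENNReal.toReal_nonneg)
    rintro v ⟨B, hB, hBx, rfl⟩
    refine ENNReal.toReal_mono hct (hB.volume_le_of_ratBox fun q hq => ?_)
    have hqx : ∀ i, x i ∉ ratBox q := fun i hi =>
      (hBx ▸ (⟨hq hi, mem_range_self i⟩ : x i ∈ B ∩ range x) : x i ∈ (∅ : Set (Fin d → ℝ)))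
    exact le_iSup₂ (f := fun (q : Fin d → ℚ × ℚ) (_ : ∀ i, x i ∉ ratBox q) =>
      cubeMeasure d (ratBox q)) q hqx
  · refine iSup₂_le fun q hq => ?_
    rw [← ENNReal.ofReal_toReal (measure_ne_top (cubeMeasure d) (ratBox q))]
    exact ENNReal.ofReal_le_ofReal
      (measureReal_pi_le_dispersion (fun k => ordConnected_Ioo) hq)

/-- The supremum over all boxes is uncountable; reducing it to rational boxes makes it a countable
supremum of functions that are constant on a measurable event and zero off it. -/
lemma measurable_dispersion {d n : ℕ} :
    Measurable (dispersion : (Fin n → Fin d → ℝ) → ℝ) := by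
  have h : Measurable fun x : Fin n → Fin d → ℝ => ENNReal.ofReal (dispersion x) := by
    simp_rw [ofReal_dispersion_eq_iSup]
    refine Measurable.iSup fun q => ?_
    have hS : MeasurableSet {x : Fin n → Fin d → ℝ | ∀ i, x i ∉ ratBox q} := by
      have h : {x : Fin n → Fin d → ℝ | ∀ i, x i ∉ ratBox q} =
          ⋂ i, (fun x => x i) ⁻¹' (ratBox q)ᶜ := by
        ext
        simp
      rw [h]
      exact MeasurableSet.iInter fun i =>
        measurable_pi_apply i (measurableSet_ratBox q).compl
    convert measurable_const.indicator (f := fun _ => cubeMeasure d (ratBox q)) hS using 2 with x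
    by_cases h : ∀ i, x i ∉ ratBox q
    · simp [indicator, h]
    · rw [iSup_neg h]
      simp only [indicator, mem_ofPred_eq, if_neg h, bot_eq_zero']
  convert h.ennreal_toReal using 2 with x
  rw [ENNReal.toReal_ofReal (dispersion_nonneg x)]

lemma integrable_dispersion {d n : ℕ} (ν : Measure (Fin n → Fin d → ℝ)) [IsFiniteMeasure ν] :
    Integrable dispersion ν :=
  Integrable.of_bound measurable_dispersion.aestronglyMeasurable 1 (ae_of_all _ fun x => by
    rw [Real.norm_of_nonneg (dispersion_nonneg x)]
    exact dispersion_le_one x)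

/-! ### Symmetrization with a ghost sample. -/

/-- Weight of a pair of points with respect to a set `B`: it vanishes if the first point lies in
`B`, and otherwise it is `2` or `1` according to whether the second one does or does not. -/
noncomputable def pairWeight {E : Type*} (B : Set E) (a b : E) : ENNReal :=
  Bᶜ.indicator 1 a * (1 + B.indicator 1 b)

lemma measurable_pairWeight {E α : Type*} [MeasurableSpace E] [MeasurableSpace α] {B : Set E}
    (hB : MeasurableSet B) {f g : α → E} (hf : Measurable f) (hg : Measurable g) :
    Measurable fun z => pairWeight B (f z) (g z) :=
  ((measurable_one.indicator hB.compl).comp hf).mul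
    (((measurable_one.indicator hB).comp hg).const_add 1)

/-- The two orders of a pair give 1 + 1, 2 + 0 or 0 + 0 according to whether none, one or both of
the points lie in `B`. The weight is designed so that its average over a swap never exceeds 1. -/
lemma sum_bool_pairWeight_le {E : Type*} (B : Set E) (z : Bool → E) :
    ∑ b, pairWeight B (z b) (z !b) ≤ 2 := by
  classical
  by_cases h1 : z true ∈ B <;> by_cases h2 : z false ∈ B <;>
    simp [pairWeight, indicator, h1, h2, one_add_one_eq_two]

open Classical in
/-- The traces of a family of sets on a finite family of points. -/
noncomputable def traces {ι κ E : Type*} [Fintype ι] (B : κ → Set E) (z : ι → E) :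
    Finset (Finset ι) :=
  Finset.univ.filter fun S => ∃ q, ∀ p, p ∈ S ↔ z p ∈ B q

/-- The weights see `B q` only through its trace on the points, so the supremum over `q` is at most
a finite sum over traces, and the sum over swaps can be done for each trace separately. -/
lemma sum_iSup_prod_pairWeight_le {ι κ E : Type*} [Fintype ι] [DecidableEq ι] (B : κ → Set E)
    (z : ι → Bool → E) :
    ∑ σ : ι → Bool, ⨆ q, ∏ i, pairWeight (B q) (z i (σ i)) (z i !(σ i)) ≤
      2 ^ Fintype.card ι * (traces B fun p : ι × Bool => z p.1 p.2).card := by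
  classical
  set T := traces B fun p : ι × Bool => z p.1 p.2 with hT
  let W : Finset (ι × Bool) → (ι → Bool) → ENNReal := fun S σ =>
    ∏ i, pairWeight {b : Bool | (i, b) ∈ S} (σ i) !(σ i)
  have hle : ∀ σ : ι → Bool, (⨆ q, ∏ i, pairWeight (B q) (z i (σ i)) (z i !(σ i))) ≤
      ∑ S ∈ T, W S σ := by
    refine fun σ => iSup_le fun q => ?_
    have hS : (Finset.univ.filter fun p : ι × Bool => z p.1 p.2 ∈ B q) ∈ T := by
      simp only [hT, traces, Finset.mem_filter, Finset.mem_univ, true_and]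
      exact ⟨q, fun p => Iff.rfl⟩
    refine le_trans (le_of_eq ?_) (Finset.single_le_sum (f := fun S => W S σ)
      (fun _ _ => zero_le) hS)
    refine Finset.prod_congr rfl fun i _ => ?_
    simp [pairWeight, indicator]
  calc ∑ σ : ι → Bool, ⨆ q, ∏ i, pairWeight (B q) (z i (σ i)) (z i !(σ i))
      ≤ ∑ σ, ∑ S ∈ T, W S σ := Finset.sum_le_sum fun σ _ => hle σ
    _ = ∑ S ∈ T, ∑ σ, W S σ := Finset.sum_comm
    _ ≤ ∑ S ∈ T, 2 ^ Fintype.card ι := by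
        refine Finset.sum_le_sum fun S _ => ?_
        -- For a fixed trace the swaps are independent: the sum over `σ` factors into one two-term
        -- sum per index, each at most 2.
        have h := Finset.prod_univ_sum (fun _ : ι => (Finset.univ : Finset Bool))
          fun i b => pairWeight {b : Bool | (i, b) ∈ S} b !b
        rw [Fintype.piFinset_univ] at h
        rw [← h]
        refine (Finset.prod_le_prod' fun i _ => sum_bool_pairWeight_le _ id).trans ?_
        simp
    _ = 2 ^ Fintype.card ι * (T.card : ENNReal) := by
        rw [Finset.sum_const, nsmul_eq_mul, mul_comm]

/-- Symmetrization: swapping independent pairs turns the expected supremum of the weights into a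
count of traces. -/
lemma lintegral_iSup_prod_pairWeight_le {ι κ E : Type*} [Fintype ι] [Countable κ]
    [MeasurableSpace E] (μ : Measure E) [IsProbabilityMeasure μ] {B : κ → Set E}
    (hB : ∀ q, MeasurableSet (B q)) {C : ℕ}
    (hC : ∀ z : ι × Bool → E, (traces B z).card ≤ C) :
    ∫⁻ x, ∫⁻ y, ⨆ q, ∏ i, pairWeight (B q) (x i) (y i) ∂(Measure.pi fun _ : ι => μ)
      ∂(Measure.pi fun _ : ι => μ) ≤ C := by
  classical
  let ρ : Measure (ι → E × E) := Measure.pi fun _ => μ.prod μ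
  let F : (ι → E × E) → ENNReal := fun z => ⨆ q, ∏ i, pairWeight (B q) (z i).1 (z i).2
  have hFm : Measurable F := Measurable.iSup fun q => Finset.measurable_fun_prod _ fun i _ =>
    measurable_pairWeight (hB q) (by fun_prop) (by fun_prop)
  have hstart : ∫⁻ x, ∫⁻ y, ⨆ q, ∏ i, pairWeight (B q) (x i) (y i) ∂(Measure.pi fun _ : ι => μ)
      ∂(Measure.pi fun _ : ι => μ) = ∫⁻ z, F z ∂ρ := by
    rw [lintegral_lintegral (f := fun x y : ι → E => ⨆ q, ∏ i, pairWeight (B q) (x i) (y i))]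
    · rw [← (measurePreserving_arrowProdEquivProdArrow E E ι (fun _ => μ)
        (fun _ => μ)).lintegral_comp_emb (MeasurableEquiv.measurableEmbedding _)]
      rfl
    · refine Measurable.aemeasurable (Measurable.iSup fun q => Finset.measurable_fun_prod _ fun i _ =>
        measurable_pairWeight (hB q) ?_ ?_) <;> fun_prop
  -- Each swap preserves `ρ`, so the integral of `F` equals its average over the 2^|ι| swaps, which
  -- is bounded pointwise.
  let s : (ι → Bool) → (ι → E × E) → (ι → E × E) := fun σ z i =>
    (if σ i then Prod.swap else id) (z i)
  have hs : ∀ σ, MeasurePreserving (s σ) ρ ρ := fun σ => by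
    refine measurePreserving_pi _ _ fun i => ?_
    cases σ i
    · exact MeasurePreserving.id _
    · exact Measure.measurePreserving_swap
  have hsum : ∀ z, ∑ σ, F (s σ z) ≤ 2 ^ Fintype.card ι * (C : ENNReal) := fun z => by
    refine le_trans (le_of_eq ?_) ((sum_iSup_prod_pairWeight_le B
      (fun i b => if b then (z i).2 else (z i).1)).trans ?_)
    · refine Finset.sum_congr rfl fun σ _ => iSup_congr fun q => Finset.prod_congr rfl fun i _ => ?_
      cases h : σ i <;> simp [s, h]
    · gcongr
      exact hC _
  have hint : 2 ^ Fintype.card ι * ∫⁻ z, F z ∂ρ = ∫⁻ z, ∑ σ, F (s σ z) ∂ρ := by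
    rw [lintegral_finsetSum (f := fun σ z => F (s σ z)) _
      fun σ _ => hFm.comp (hs σ).measurable]
    simp_rw [(hs _).lintegral_comp hFm]
    simp
  rw [hstart]
  have h2 : (2 : ENNReal) ^ Fintype.card ι * ∫⁻ z, F z ∂ρ ≤ 2 ^ Fintype.card ι * C := by
    rw [hint]
    calc ∫⁻ z, ∑ σ, F (s σ z) ∂ρ ≤ ∫⁻ _, 2 ^ Fintype.card ι * (C : ENNReal) ∂ρ :=
          lintegral_mono hsum
      _ = 2 ^ Fintype.card ι * C := by simp
  exact (ENNReal.mul_le_mul_iff_right (by simp) (by simp)).1 h2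

lemma lintegral_pi_prod_eq_pow {ι E : Type*} [Fintype ι] [MeasurableSpace E] (μ : Measure E)
    [IsProbabilityMeasure μ] {f : E → ENNReal} (hf : Measurable f) :
    ∫⁻ x, ∏ i, f (x i) ∂(Measure.pi fun _ : ι => μ) = (∫⁻ a, f a ∂μ) ^ Fintype.card ι := by
  rw [ProbabilityTheory.lintegral_prod_eq_prod_lintegral_of_indepFun Finset.univ
    (fun i (x : ι → E) => f (x i))
    (ProbabilityTheory.iIndepFun_pi fun i => hf.aemeasurable)
    (fun i => hf.comp (measurable_pi_apply i))]
  have : ∀ i : ι, ∫⁻ x, f (x i) ∂(Measure.pi fun _ : ι => μ) = ∫⁻ a, f a ∂μ := fun i =>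
    (measurePreserving_eval (fun _ : ι => μ) i).lintegral_comp hf
  simp [this]

lemma lintegral_prod_pairWeight {ι E : Type*} [Fintype ι] [MeasurableSpace E] (μ : Measure E)
    [IsProbabilityMeasure μ] {B : Set E} (hB : MeasurableSet B) {x : ι → E}
    (hx : ∀ i, x i ∉ B) :
    ∫⁻ y, ∏ i, pairWeight B (x i) (y i) ∂(Measure.pi fun _ : ι => μ) =
      (1 + μ B) ^ Fintype.card ι := by
  have h : ∀ y : ι → E, ∏ i, pairWeight B (x i) (y i) = ∏ i, (1 + B.indicator 1 (y i)) :=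
    fun y => Finset.prod_congr rfl fun i _ => by simp [pairWeight, hx i]
  simp_rw [h]
  rw [lintegral_pi_prod_eq_pow μ (f := fun a => 1 + B.indicator 1 a)
    ((measurable_one.indicator hB).const_add 1),
    lintegral_add_left measurable_const, lintegral_indicator_one hB]
  simp

/-! ### Counting the traces of boxes. -/

/-- Coordinate boxes in dimension `d` have Vapnik-Chervonenkis dimension at most `2 * d`. -/
lemma vcDim_traces_ratBox_le {ι : Type*} [Fintype ι] [DecidableEq ι] {d : ℕ}
    (z : ι → Fin d → ℝ) : (traces ratBox z).vcDim ≤ 2 * d := by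
  classical
  refine Finset.sup_le fun A hA => ?_
  rw [Finset.mem_shatterer] at hA
  rcases A.eq_empty_or_nonempty with rfl | hne
  · simp
  choose lo hlo hlo' using fun k => A.exists_min_image (fun p => z p k) hne
  choose hi hhi hhi' using fun k => A.exists_max_image (fun p => z p k) hne
  -- Extremal points of `A` in each direction, at most 2d of them. A box containing these contains
  -- all of `A`, so a shattered `A` equals `W`.
  let W : Finset ι := Finset.univ.image lo ∪ Finset.univ.image hi
  have hWA : W ⊆ A := by
    intro p hp
    simp only [W, Finset.mem_union, Finset.mem_image, Finset.mem_univ, true_and] at hp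
    rcases hp with ⟨k, rfl⟩ | ⟨k, rfl⟩
    exacts [hlo k, hhi k]
  have hWc : W.card ≤ 2 * d := by
    refine (Finset.card_union_le _ _).trans ?_
    have h1 := Finset.card_image_le (s := (Finset.univ : Finset (Fin d))) (f := lo)
    have h2 := Finset.card_image_le (s := (Finset.univ : Finset (Fin d))) (f := hi)
    simp only [Finset.card_univ, Fintype.card_fin] at h1 h2
    omega
  obtain ⟨S, hS, hAS⟩ := hA hWA
  simp only [traces, Finset.mem_filter, Finset.mem_univ, true_and] at hS
  obtain ⟨q, hq⟩ := hS
  have hWS : ∀ p ∈ W, z p ∈ ratBox q := fun p hp =>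
    (hq p).1 (Finset.mem_inter.1 (hAS.symm ▸ hp : p ∈ A ∩ S)).2
  have hAW : A ⊆ W := by
    intro p hp
    rw [← hAS]
    refine Finset.mem_inter.2 ⟨hp, (hq p).2 fun k _ => ?_⟩
    have h1 : z (lo k) ∈ ratBox q := hWS _ (by simp [W])
    have h2 : z (hi k) ∈ ratBox q := hWS _ (by simp [W])
    exact ⟨(h1 k trivial).1.trans_le (hlo' k p hp), (hhi' k p hp).trans_lt (h2 k trivial).2⟩
  exact (Finset.card_le_card hAW).trans hWc

lemma card_traces_ratBox_le {ι : Type*} [Fintype ι] {d : ℕ} (z : ι → Fin d → ℝ) :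
    (traces ratBox z).card ≤ ∑ k ∈ Finset.Iic (2 * d), (Fintype.card ι).choose k := by
  classical
  refine (Finset.card_le_card_shatterer _).trans
    (Finset.card_shatterer_le_sum_vcDim.trans ?_)
  exact Finset.sum_le_sum_of_subset (Finset.Iic_subset_Iic.2 (vcDim_traces_ratBox_le z))

/-- For k ≤ D the factor (m/D)^(D-k) is at least 1. Inserting it and extending the sum to all k ≤ m
gives (m/D)^D (1 + D/m)^m by the binomial theorem, and (1 + D/m)^m ≤ e^D. -/
lemma sum_choose_le_pow {m D : ℕ} (hD : 0 < D) (hm : D ≤ m) :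
    ((∑ k ∈ Finset.Iic D, m.choose k : ℕ) : ℝ) ≤ (Real.exp 1 * m / D) ^ D := by
  have hD' : (0 : ℝ) < D := by exact_mod_cast hD
  have hm' : (0 : ℝ) < m := by exact_mod_cast hD.trans_le hm
  have hr : 1 ≤ (m : ℝ) / D := by
    rw [one_le_div hD']
    exact_mod_cast hm
  have hr0 : (0 : ℝ) < m / D := by positivity
  calc ((∑ k ∈ Finset.Iic D, m.choose k : ℕ) : ℝ)
      = ∑ k ∈ Finset.Iic D, (m.choose k : ℝ) := by push_cast; rfl
    _ ≤ ∑ k ∈ Finset.Iic D, (m / D : ℝ) ^ D * ((D / m : ℝ) ^ k * m.choose k) := by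
        refine Finset.sum_le_sum fun k hk => ?_
        have hk' : k ≤ D := Finset.mem_Iic.1 hk
        have h1 : (1 : ℝ) ≤ (m / D : ℝ) ^ D * (D / m : ℝ) ^ k := by
          have : (m / D : ℝ) ^ D * (D / m : ℝ) ^ k = (m / D : ℝ) ^ (D - k) := by
            rw [← inv_div (m : ℝ) D, inv_pow, pow_sub₀ _ hr0.ne' hk']
          rw [this]
          exact one_le_pow₀ hr
        rw [← mul_assoc]
        exact le_mul_of_one_le_left (Nat.cast_nonneg _) h1
    _ ≤ ∑ k ∈ Finset.range (m + 1), (m / D : ℝ) ^ D * ((D / m : ℝ) ^ k * m.choose k) := by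
        refine Finset.sum_le_sum_of_subset_of_nonneg (fun k hk => ?_) fun k _ _ => by positivity
        have := Finset.mem_Iic.1 hk
        exact Finset.mem_range.2 (by omega)
    _ = (m / D : ℝ) ^ D * (D / m + 1) ^ m := by
        rw [← Finset.mul_sum, add_pow]
        simp
    _ ≤ (m / D : ℝ) ^ D * Real.exp 1 ^ D := by
        gcongr
        calc ((D : ℝ) / m + 1) ^ m ≤ Real.exp (D / m) ^ m := by
              gcongr
              exact Real.add_one_le_exp _
          _ = Real.exp 1 ^ D := by
              rw [← Real.exp_nat_mul, ← Real.exp_nat_mul]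
              congr 1
              field_simp
    _ = (Real.exp 1 * m / D) ^ D := by
        rw [← mul_pow]
        congr 1
        ring

/-! ### The upper bound. -/

lemma one_add_dispersion_pow_le {d n : ℕ} (hd : 1 ≤ d) (hn : n ≠ 0) (x : Fin n → Fin d → ℝ) :
    ENNReal.ofReal ((1 + dispersion x) ^ n) ≤
      ∫⁻ y, ⨆ q : Fin d → ℚ × ℚ, ∏ i, pairWeight (ratBox q) (x i) (y i)
        ∂(Measure.pi fun _ : Fin n => cubeMeasure d) := by
  set c := ∫⁻ y, ⨆ q : Fin d → ℚ × ℚ, ∏ i, pairWeight (ratBox q) (x i) (y i)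
        ∂(Measure.pi fun _ : Fin n => cubeMeasure d) with hc
  have hn0 : (0 : ℝ) < n := by positivity
  -- Taking n-th roots first makes the bound linear in the volume, so the supremum over boxes can be
  -- taken afterwards.
  have hq : ∀ q : Fin d → ℚ × ℚ, (∀ i, x i ∉ ratBox q) →
      1 + cubeMeasure d (ratBox q) ≤ c ^ (n : ℝ)⁻¹ := by
    intro q hq
    rw [ENNReal.le_rpow_inv_iff hn0, ENNReal.rpow_natCast]
    have h := lintegral_prod_pairWeight (cubeMeasure d) (measurableSet_ratBox q) hq
    rw [Fintype.card_fin] at h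
    rw [← h]
    exact lintegral_mono fun y =>
      le_iSup (fun q : Fin d → ℚ × ℚ => ∏ i, pairWeight (ratBox q) (x i) (y i)) q
  -- The empty box, available because d ≥ 1, ensures that the truncated subtraction of 1 below loses
  -- nothing.
  have h1 : 1 ≤ c ^ (n : ℝ)⁻¹ := by
    have he : ratBox (0 : Fin d → ℚ × ℚ) = ∅ := univ_pi_eq_empty (i := ⟨0, hd⟩) (by simp)
    exact le_self_add.trans (hq 0 fun i => by simp [he])
  have h2 : 1 + ENNReal.ofReal (dispersion x) ≤ c ^ (n : ℝ)⁻¹ := by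
    rw [ofReal_dispersion_eq_iSup, add_comm]
    refine (add_le_add_left (iSup₂_le fun q h => ENNReal.le_sub_of_add_le_left
      ENNReal.one_ne_top (hq q h)) 1).trans (tsub_add_cancel_of_le h1).le
  rw [ENNReal.le_rpow_inv_iff hn0, ENNReal.rpow_natCast] at h2
  rwa [ENNReal.ofReal_pow (by linarith [dispersion_nonneg x]),
    ENNReal.ofReal_add zero_le_one (dispersion_nonneg x), ENNReal.ofReal_one]

/-- The `n`-th moment of `1 + dispersion` is bounded by the growth function of boxes. -/
lemma integral_one_add_dispersion_pow_le {d n : ℕ} (hd : 1 ≤ d) (hn : d < n) :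
    ∫ x, (1 + dispersion x) ^ n ∂(Measure.pi fun _ : Fin n => cubeMeasure d) ≤
      (Real.exp 1 * n / d) ^ (2 * d) := by
  set C : ℕ := ∑ k ∈ Finset.Iic (2 * d), (2 * n).choose k with hC
  have h1 : ∫⁻ x, ENNReal.ofReal ((1 + dispersion x) ^ n)
      ∂(Measure.pi fun _ : Fin n => cubeMeasure d) ≤ C := by
    refine (lintegral_mono fun x => one_add_dispersion_pow_le hd (by omega) x).trans
      (lintegral_iSup_prod_pairWeight_le (cubeMeasure d) measurableSet_ratBox fun z => ?_)
    refine (card_traces_ratBox_le z).trans (le_of_eq ?_)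
    simp [hC, mul_comm]
  have h2 : (C : ℝ) ≤ (Real.exp 1 * n / d) ^ (2 * d) := by
    refine (sum_choose_le_pow (by omega) (by omega)).trans (le_of_eq ?_)
    have : (0 : ℝ) < d := by exact_mod_cast hd
    push_cast
    congr 1
    field_simp
  rw [integral_eq_lintegral_of_nonneg_ae
    (ae_of_all _ fun x => pow_nonneg (by linarith [dispersion_nonneg x]) n)
    ((measurable_dispersion.const_add 1).pow_const n).aestronglyMeasurable]
  refine le_trans ?_ h2
  exact ENNReal.toReal_le_of_le_ofReal (Nat.cast_nonneg _) (by simpa using h1)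

lemma integral_dispersion_le {d n : ℕ} (hd : 1 ≤ d) (hn : d < n) :
    ∫ x, dispersion x ∂(Measure.pi fun _ : Fin n => cubeMeasure d) ≤
      9 * d / n * Real.log (Real.exp 1 * n / d) := by
  set ν := Measure.pi fun _ : Fin n => cubeMeasure d
  set m := ∫ x, dispersion x ∂ν with hm
  have hd0 : (0 : ℝ) < d := by exact_mod_cast hd
  have hn0 : (0 : ℝ) < n := by exact_mod_cast (by omega : 0 < n)
  have hm0 : 0 ≤ m := integral_nonneg dispersion_nonneg
  have hm1 : m ≤ 1 := by
    have := integral_mono (integrable_dispersion ν) (integrable_const (1 : ℝ)) dispersion_le_one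
    simpa using this
  have hint : ∫ x, (1 + dispersion x) ∂ν = 1 + m := by
    rw [integral_add (integrable_const _) (integrable_dispersion ν)]
    simp [hm]
  have hjensen : (1 + m) ^ n ≤ ∫ x, (1 + dispersion x) ^ n ∂ν := by
    have h := (convexOn_pow (𝕜 := ℝ) n).map_integral_le (μ := ν)
      (f := fun x : Fin n → Fin d → ℝ => 1 + dispersion x)
      (continuous_pow n).continuousOn isClosed_Ici
      (ae_of_all _ fun x => by simpa using (by linarith [dispersion_nonneg x] : 0 ≤ 1 + dispersion x))
      ((integrable_const _).add (integrable_dispersion ν)) ?_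
    · rwa [hint] at h
    · refine Integrable.of_bound
        ((measurable_dispersion.const_add 1).pow_const n).aestronglyMeasurable
        ((2 : ℝ) ^ n) (ae_of_all _ fun x => ?_)
      have h0 := dispersion_nonneg x
      have h1 := dispersion_le_one x
      simp only [Function.comp_apply]
      rw [Real.norm_of_nonneg (by positivity)]
      exact pow_le_pow_left₀ (by linarith) (by linarith) n
  have hpow := hjensen.trans (integral_one_add_dispersion_pow_le hd hn)
  have hlog := Real.log_le_log (by positivity) hpow
  rw [Real.log_pow, Real.log_pow] at hlog
  -- From log(1 + m) ≥ 2m/(m + 2) and m ≤ 1. Together with n log(1 + m) ≤ 2dL this yields even mn ≤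
  -- 3dL.
  have hlow : 2 * m / 3 ≤ Real.log (1 + m) := by
    refine le_trans ?_ (Real.le_log_one_add_of_nonneg hm0)
    exact div_le_div_of_nonneg_left (by linarith) (by linarith) (by linarith)
  push_cast at hlog
  set L := Real.log (Real.exp 1 * n / d)
  have hL : 0 ≤ L := by
    have h1 : (0 : ℝ) ≤ n * (2 * m / 3) := by positivity
    have h2 := mul_le_mul_of_nonneg_left hlow hn0.le
    have h3 : 0 ≤ 2 * (d : ℝ) * L := by linarith
    exact nonneg_of_mul_nonneg_right h3 (by positivity)
  have hfin : m * n ≤ 9 * d * L := by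
    have h2 := mul_le_mul_of_nonneg_left hlow hn0.le
    have h3 : 0 ≤ (d : ℝ) * L := by positivity
    linarith
  rw [div_mul_eq_mul_div, le_div_iff₀ hn0]
  exact hfin

/-! ### The lower bound linear in the dimension. -/

lemma integral_dispersion_ge_of_le {d n : ℕ} {g : (Fin n → Fin d → ℝ) → ℝ}
    (ν : Measure (Fin n → Fin d → ℝ)) [IsFiniteMeasure ν] (hg : ∀ x, 0 ≤ g x)
    (h : ∀ᵐ x ∂ν, g x ≤ dispersion x) : ∫ x, g x ∂ν ≤ ∫ x, dispersion x ∂ν :=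
  integral_mono_of_nonneg (ae_of_all _ hg) (integrable_dispersion ν) h

lemma ae_pi_mem_unitCube (d n : ℕ) :
    ∀ᵐ x ∂(Measure.pi fun _ : Fin n => cubeMeasure d), ∀ i, x i ∈ unitCube d := by
  refine ae_all_iff.2 fun i => ?_
  exact (measurePreserving_eval (fun _ : Fin n => cubeMeasure d) i).quasiMeasurePreserving.ae
    (ae_restrict_mem (measurableSet_unitCube d))

lemma cubeMeasure_pi_Ico_zero {d : ℕ} {b : Fin d → ℝ} (hb0 : ∀ k, 0 ≤ b k) (hb : ∀ k, b k ≤ 1) :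
    (cubeMeasure d).real (univ.pi fun k => Ico 0 (b k)) = ∏ k, b k := by
  have hsub : (univ.pi fun k => Ico 0 (b k)) ⊆ unitCube d :=
    pi_mono fun k _ => Ico_subset_Icc_self.trans (Icc_subset_Icc_right (hb k))
  rw [Measure.real, cubeMeasure, Measure.restrict_eq_self _ hsub, Real.volume_pi_Ico_toReal hb0]
  simp

/-- Cutting `[0,r)^d` at the largest coordinate of each point produces an empty box. -/
lemma pow_mul_prod_min_norm_le_dispersion {d n : ℕ} (hd : 1 ≤ d) {r : ℝ} (hr : 0 < r)
    (hr1 : r ≤ 1) {x : Fin n → Fin d → ℝ} (hx : ∀ i, x i ∈ unitCube d) :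
    r ^ d * ∏ i, min 1 (‖x i‖ / r) ≤ dispersion x := by
  classical
  have : Nonempty (Fin d) := ⟨⟨0, hd⟩⟩
  have hφ0 : ∀ i, 0 ≤ min 1 (‖x i‖ / r) := fun i => by positivity
  have hφ1 : ∀ i, min 1 (‖x i‖ / r) ≤ 1 := fun i => min_le_left _ _
  have hmax : ∀ i, ∃ k, ‖x i‖ ≤ x i k := fun i => by
    obtain ⟨k, -, hk⟩ := Finset.univ.exists_max_image (x i) Finset.univ_nonempty
    refine ⟨k, (pi_norm_le_iff_of_nonneg (hx i k trivial).1).2 fun l => ?_⟩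
    rw [Real.norm_of_nonneg (hx i l trivial).1]
    exact hk l (Finset.mem_univ l)
  choose κ hκ using hmax
  -- Each point shrinks only the side `κ i`, so over all sides every factor appears exactly once. As
  -- the other factors are at most 1, side `κ i` ends at or below `‖x i‖`, which excludes the point.
  let b : Fin d → ℝ := fun k => r * ∏ i with κ i = k, min 1 (‖x i‖ / r)
  have hb0 : ∀ k, 0 ≤ b k := fun k => mul_nonneg hr.le (Finset.prod_nonneg fun i _ => hφ0 i)
  have hb1 : ∀ k, b k ≤ 1 := fun k => mul_le_one₀ hr1 (Finset.prod_nonneg fun i _ => hφ0 i)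
    (Finset.prod_le_one (fun i _ => hφ0 i) fun i _ => hφ1 i)
  have hvol : ∏ k, b k = r ^ d * ∏ i, min 1 (‖x i‖ / r) := by
    simp only [b]
    rw [Finset.prod_mul_distrib, Finset.prod_fiberwise]
    simp
  rw [← hvol, ← cubeMeasure_pi_Ico_zero hb0 hb1]
  refine measureReal_pi_le_dispersion (fun k => ordConnected_Ico) fun i hi => ?_
  have hlt := (hi (κ i) trivial).2
  have hle : b (κ i) ≤ x i (κ i) := by
    calc b (κ i) ≤ r * min 1 (‖x i‖ / r) := by
          refine mul_le_mul_of_nonneg_left ?_ hr.le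
          rw [← Finset.mul_prod_erase _ _ (show i ∈ Finset.univ.filter fun j => κ j = κ i by simp)]
          exact mul_le_of_le_one_right (hφ0 i)
            (Finset.prod_le_one (fun j _ => hφ0 j) fun j _ => hφ1 j)
      _ ≤ r * (‖x i‖ / r) := mul_le_mul_of_nonneg_left (min_le_right _ _) hr.le
      _ = ‖x i‖ := by field_simp
      _ ≤ x i (κ i) := hκ i
  exact absurd hlt (not_lt.2 hle)

/-- Layer cake: the norm is the maximum norm, so for 0 < t < 1 the integrand exceeds t with
probability 1 - (rt)^d, the complement of the cube [0,rt]^d. -/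
lemma integral_min_norm {d : ℕ} {r : ℝ} (hr : 0 < r) (hr1 : r ≤ 1) :
    ∫ a, min 1 (‖a‖ / r) ∂(cubeMeasure d) = 1 - r ^ d / (d + 1) := by
  have hmeas : Measurable fun a : Fin d → ℝ => min 1 (‖a‖ / r) := by fun_prop
  have hint : Integrable (fun a : Fin d → ℝ => min 1 (‖a‖ / r)) (cubeMeasure d) := by
    refine Integrable.of_bound hmeas.aestronglyMeasurable 1 (ae_of_all _ fun a => ?_)
    rw [Real.norm_of_nonneg (by positivity)]
    exact min_le_left _ _
  rw [hint.integral_eq_integral_meas_lt (ae_of_all _ fun a => by positivity)]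
  have hval : ∀ t : ℝ, 0 < t → (cubeMeasure d).real {a | t < min 1 (‖a‖ / r)} =
      (Ioo (0 : ℝ) 1).indicator (fun t => 1 - (r * t) ^ d) t := by
    intro t ht
    by_cases ht1 : t < 1
    swap
    · have he : {a : Fin d → ℝ | t < min 1 (‖a‖ / r)} = ∅ :=
        eq_empty_of_forall_notMem fun a ha =>
          ht1 ((show t < min 1 (‖a‖ / r) from ha).trans_le (min_le_left _ _))
      rw [he, indicator_of_notMem fun h => ht1 h.2]
      simp
    have hrt0 : 0 ≤ r * t := by positivity
    have hrt1 : r * t ≤ 1 := mul_le_one₀ hr1 ht.le ht1.le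
    have hcompl : {a : Fin d → ℝ | t < min 1 (‖a‖ / r)} = {a | ‖a‖ ≤ r * t}ᶜ := by
      ext a
      simp [ht1, lt_div_iff₀ hr, mul_comm]
    have hinter : {a : Fin d → ℝ | ‖a‖ ≤ r * t} ∩ unitCube d =
        univ.pi fun _ => Icc 0 (r * t) := by
      ext a
      simp only [unitCube, mem_inter_iff, mem_ofPred_eq, mem_univ_pi, mem_Icc,
        pi_norm_le_iff_of_nonneg hrt0, Real.norm_eq_abs, abs_le]
      exact ⟨fun h k => ⟨(h.2 k).1, (h.1 k).2⟩, fun h => ⟨fun k =>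
        ⟨by linarith [(h k).1], (h k).2⟩, fun k => ⟨(h k).1, (h k).2.trans hrt1⟩⟩⟩
    rw [hcompl, probReal_compl_eq_one_sub (measurableSet_le (by fun_prop) (by fun_prop)),
      indicator_of_mem (show t ∈ Ioo (0 : ℝ) 1 from ⟨ht, ht1⟩), Measure.real, cubeMeasure,
      Measure.restrict_apply' (measurableSet_unitCube d), hinter, volume_pi_pi]
    simp [ENNReal.toReal_ofReal hrt0]
  rw [setIntegral_congr_fun measurableSet_Ioi fun t ht => hval t ht,
    setIntegral_indicator measurableSet_Ioo,
    inter_eq_self_of_subset_right Ioo_subset_Ioi_self,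
    ← integral_Ioc_eq_integral_Ioo, ← intervalIntegral.integral_of_le zero_le_one]
  simp_rw [mul_pow]
  rw [intervalIntegral.integral_sub (by simp) (by apply Continuous.intervalIntegrable; fun_prop),
    intervalIntegral.integral_const_mul, integral_pow]
  simp
  ring

lemma integral_dispersion_ge_dim {d n : ℕ} (hd : 1 ≤ d) (hn : d < n) :
    (d : ℝ) / (2 * Real.exp 1 * n) ≤
      ∫ x, dispersion x ∂(Measure.pi fun _ : Fin n => cubeMeasure d) := by
  set ν := Measure.pi fun _ : Fin n => cubeMeasure d
  have hd0 : (0 : ℝ) < d := by exact_mod_cast hd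
  have hdn : (d : ℝ) + 1 ≤ n := by exact_mod_cast hn
  have hn0 : (0 : ℝ) < n := by linarith
  -- The maximizer of s (1 - s/(d+1))^n, where s = r^d. It makes the base equal to 1/(1 + 1/n),
  -- whose n-th power is at least 1/e.
  set s : ℝ := (d + 1) / (n + 1) with hs
  have hs0 : 0 < s := by positivity
  have hs1 : s ≤ 1 := by
    rw [hs, div_le_one (by positivity)]
    linarith
  set r : ℝ := s ^ (d : ℝ)⁻¹ with hr
  have hr0 : 0 < r := Real.rpow_pos_of_pos hs0 _
  have hr1 : r ≤ 1 := Real.rpow_le_one hs0.le hs1 (by positivity)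
  have hrs : r ^ d = s := Real.rpow_inv_natCast_pow hs0.le (by omega)
  have hmono := integral_dispersion_ge_of_le ν (g := fun x => r ^ d * ∏ i, min 1 (‖x i‖ / r))
    (fun x => mul_nonneg (by positivity) (Finset.prod_nonneg fun i _ => by positivity))
    ((ae_pi_mem_unitCube d n).mono fun x hx =>
      pow_mul_prod_min_norm_le_dispersion hd hr0 hr1 hx)
  rw [integral_const_mul,
    integral_fintype_prod_eq_pow (𝕜 := ℝ) (fun a : Fin d → ℝ => min 1 (‖a‖ / r)),
    integral_min_norm hr0 hr1, hrs, Fintype.card_fin] at hmono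
  refine le_trans ?_ hmono
  have hbase : 1 - s / (d + 1) = ((n : ℝ)⁻¹ + 1)⁻¹ := by
    rw [hs]
    field_simp
    ring
  have hexp : (Real.exp 1)⁻¹ ≤ (1 - s / (d + 1)) ^ n := by
    rw [hbase, inv_pow]
    refine inv_anti₀ (by positivity) ?_
    calc ((n : ℝ)⁻¹ + 1) ^ n ≤ Real.exp ((n : ℝ)⁻¹) ^ n := by
          gcongr
          exact Real.add_one_le_exp _
      _ = Real.exp 1 := by
          rw [← Real.exp_nat_mul, mul_inv_cancel₀ hn0.ne']
  have hsd : (d : ℝ) / (2 * n) ≤ s := by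
    rw [hs, div_le_div_iff₀ (by positivity) (by positivity)]
    nlinarith
  calc (d : ℝ) / (2 * Real.exp 1 * n) = d / (2 * n) * (Real.exp 1)⁻¹ := by
        field_simp
    _ ≤ s * (1 - s / (d + 1)) ^ n := by gcongr

/-! ### The logarithmic lower bound: second moment method on slabs. -/

lemma measurableSet_exists_missed {ι κ E : Type*} [Countable ι] [Countable κ] [MeasurableSpace E]
    {S : κ → Set E} (hS : ∀ j, MeasurableSet (S j)) :
    MeasurableSet {x : ι → E | ∃ j, ∀ i, x i ∉ S j} := by
  have h : {x : ι → E | ∃ j, ∀ i, x i ∉ S j} = ⋃ j, ⋂ i, (fun x => x i) ⁻¹' (S j)ᶜ := by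
    ext
    simp
  rw [h]
  exact MeasurableSet.iUnion fun j => MeasurableSet.iInter fun i =>
    measurable_pi_apply i (hS j).compl

/-- Second moment method: if `m` is the expected number of sets in a disjoint family of equally
likely sets that are missed by a random sample, then some set is missed with probability at least
`m / (1 + m)`. -/
lemma le_measureReal_exists_missed {ι κ E : Type*} [Fintype ι] [Fintype κ] [MeasurableSpace E]
    (μ : Measure E) [IsProbabilityMeasure μ] {S : κ → Set E} (hS : ∀ j, MeasurableSet (S j))
    (hdisj : Pairwise fun j l => Disjoint (S j) (S l)) {p m : ℝ} (hp : ∀ j, μ.real (S j) = p)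
    (hm : m = Fintype.card κ * (1 - p) ^ Fintype.card ι) (hm0 : 0 ≤ m) :
    m / (1 + m) ≤ (Measure.pi fun _ : ι => μ).real {x | ∃ j, ∀ i, x i ∉ S j} := by
  classical
  set ν := Measure.pi fun _ : ι => μ
  let c : Set E → (ι → E) → ℝ := fun A x => ∏ i, Aᶜ.indicator 1 (x i)
  have hc : ∀ A, MeasurableSet A → ∫ x, c A x ∂ν = (1 - μ.real A) ^ Fintype.card ι := by
    intro A hA
    rw [integral_fintype_prod_eq_pow (𝕜 := ℝ) (Aᶜ.indicator 1), integral_indicator_one hA.compl,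
      probReal_compl_eq_one_sub hA]
  have hcm : ∀ A, MeasurableSet A → Measurable (c A) := fun A hA =>
    Finset.measurable_fun_prod _ fun i _ =>
      (measurable_one.indicator hA.compl).comp (measurable_pi_apply i)
  have hc01 : ∀ A x, 0 ≤ c A x ∧ c A x ≤ 1 := fun A x =>
    ⟨Finset.prod_nonneg fun i _ => indicator_nonneg (fun _ _ => zero_le_one) _,
      Finset.prod_le_one (fun i _ => indicator_nonneg (fun _ _ => zero_le_one) _)
        fun i _ => indicator_le_self' (fun _ _ => zero_le_one) _⟩
  have hci : ∀ A, MeasurableSet A → Integrable (c A) ν := fun A hA =>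
    Integrable.of_bound (hcm A hA).aestronglyMeasurable 1 (ae_of_all _ fun x => by
      rw [Real.norm_of_nonneg (hc01 A x).1]
      exact (hc01 A x).2)
  have hmul : ∀ A B x, c A x * c B x = c (A ∪ B) x := fun A B x => by
    simp only [c]
    rw [← Finset.prod_mul_distrib]
    refine Finset.prod_congr rfl fun i _ => ?_
    by_cases h1 : x i ∈ A <;> by_cases h2 : x i ∈ B <;> simp [h1, h2]
  let Z : (ι → E) → ℝ := fun x => ∑ j, c (S j) x
  have hZ2 : ∀ x, Z x ^ 2 = ∑ j, ∑ l, c (S j ∪ S l) x := fun x => by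
    simp only [Z]
    rw [sq, Finset.sum_mul_sum]
    simp_rw [hmul]
  have hZi : Integrable Z ν := integrable_finsetSum _ fun j _ => hci _ (hS j)
  have hZ2i : Integrable (fun x => Z x ^ 2) ν := by
    simp_rw [hZ2]
    exact integrable_finsetSum _ fun j _ => integrable_finsetSum _ fun l _ =>
      hci _ ((hS j).union (hS l))
  have hEZ : ∫ x, Z x ∂ν = m := by
    rw [integral_finsetSum _ fun j _ => hci _ (hS j)]
    simp [hc _ (hS _), hp, hm]
  have hpair : ∀ j l, ∫ x, c (S j ∪ S l) x ∂ν ≤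
      (if j = l then (1 - p) ^ Fintype.card ι else 0) + ((1 - p) ^ Fintype.card ι) ^ 2 := by
    intro j l
    rw [hc _ ((hS j).union (hS l))]
    split_ifs with h
    · subst h
      rw [union_self, hp]
      exact le_add_of_nonneg_right (sq_nonneg _)
    · have hu : μ.real (S j ∪ S l) = p + p := by
        rw [measureReal_union (hdisj h) (hS l), hp, hp]
      have hle : μ.real (S j ∪ S l) ≤ 1 := measureReal_le_one
      -- Missing two disjoint sets is negatively correlated: 1 - 2p ≤ (1 - p)^2. The left side is
      -- nonnegative because the union has measure at most 1.
      rw [zero_add, ← pow_mul, mul_comm, pow_mul]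
      refine pow_le_pow_left₀ (by linarith) ?_ _
      rw [hu]
      nlinarith [sq_nonneg p]
  have hEZ2 : ∫ x, Z x ^ 2 ∂ν ≤ m + m ^ 2 := by
    simp_rw [hZ2]
    rw [integral_finsetSum _ fun j _ => integrable_finsetSum _ fun l _ =>
      hci _ ((hS j).union (hS l))]
    simp_rw [integral_finsetSum _ fun l _ => hci _ ((hS _).union (hS l))]
    refine (Finset.sum_le_sum fun j _ => Finset.sum_le_sum fun l _ => hpair j l).trans
      (le_of_eq ?_)
    simp [Finset.sum_add_distrib, hm]
    ring
  set A : Set (ι → E) := {x | ∃ j, ∀ i, x i ∉ S j} with hA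
  have hAm : MeasurableSet A := measurableSet_exists_missed hS
  -- Replaces Cauchy–Schwarz: 2tZ - t²Z² ≤ 1 always, and it is 0 where Z = 0. This t maximizes the
  -- resulting bound 2tm - t²(m + m²).
  set t : ℝ := 1 / (1 + m) with ht
  have hpt : ∀ x, 2 * t * Z x - t ^ 2 * Z x ^ 2 ≤ A.indicator 1 x := by
    intro x
    by_cases hx : x ∈ A
    · rw [indicator_of_mem hx]
      simp only [Pi.one_apply]
      nlinarith [sq_nonneg (1 - t * Z x)]
    · have hz : Z x = 0 := by
        refine Finset.sum_eq_zero fun j _ => ?_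
        have : ∃ i, x i ∈ S j := by
          by_contra hcon
          exact hx ⟨j, fun i hi => hcon ⟨i, hi⟩⟩
        obtain ⟨i, hi⟩ := this
        exact Finset.prod_eq_zero (Finset.mem_univ i) (by simp [hi])
      rw [indicator_of_notMem hx, hz]
      simp
  have hmono := integral_mono ((hZi.const_mul (2 * t)).sub (hZ2i.const_mul (t ^ 2)))
    ((integrable_const (1 : ℝ)).indicator hAm) hpt
  rw [integral_sub' (hZi.const_mul (2 * t)) (hZ2i.const_mul (t ^ 2)), integral_const_mul,
    integral_const_mul, hEZ] at hmono
  have hind : ∫ x, A.indicator (fun _ => (1 : ℝ)) x ∂ν = ν.real A := integral_indicator_one hAm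
  rw [hind] at hmono
  refine le_trans ?_ hmono
  have h1 := mul_le_mul_of_nonneg_left hEZ2 (sq_nonneg t)
  have h2 : m / (1 + m) = 2 * t * m - t ^ 2 * (m + m ^ 2) := by
    rw [ht]
    field_simp
    ring
  linarith

/-- The slab of points of `ℝ^d` whose `k`-th coordinate lies in `[j / N, (j + 1) / N)`. -/
def slab {d : ℕ} (N : ℕ) (k : Fin d) (j : Fin N) : Set (Fin d → ℝ) :=
  univ.pi (Function.update (fun _ => univ) k (Ico ((j : ℝ) / N) (((j : ℝ) + 1) / N)))

lemma mem_slab_iff {d N : ℕ} {k : Fin d} {j : Fin N} {a : Fin d → ℝ} :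
    a ∈ slab N k j ↔ a k ∈ Ico ((j : ℝ) / N) (((j : ℝ) + 1) / N) := by
  refine ⟨fun h => by simpa using h k trivial, fun h l _ => ?_⟩
  rcases eq_or_ne l k with rfl | hl
  · simpa using h
  · simp [Function.update_of_ne hl]

lemma ordConnected_slab_side {d N : ℕ} (k : Fin d) (j : Fin N) (l : Fin d) :
    (Function.update (fun _ : Fin d => (univ : Set ℝ)) k
      (Ico ((j : ℝ) / N) (((j : ℝ) + 1) / N)) l).OrdConnected := by
  rcases eq_or_ne l k with rfl | hl
  · simpa using ordConnected_Ico
  · simpa [Function.update_of_ne hl] using ordConnected_univ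

lemma measurableSet_slab {d N : ℕ} (k : Fin d) (j : Fin N) : MeasurableSet (slab N k j) :=
  MeasurableSet.univ_pi fun l => (ordConnected_slab_side k j l).measurableSet

lemma pairwise_disjoint_slab {d N : ℕ} (k : Fin d) :
    Pairwise fun j l : Fin N => Disjoint (slab N k j) (slab N k l) := by
  have key : ∀ (j l : Fin N) (a : Fin d → ℝ), a ∈ slab N k j → a ∈ slab N k l → (j : ℕ) ≤ l := by
    intro j l a hj hl
    have hN : (0 : ℝ) < N := by exact_mod_cast j.pos
    have h := (mem_slab_iff.1 hj).1.trans_lt (mem_slab_iff.1 hl).2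
    rw [div_lt_div_iff_of_pos_right hN] at h
    exact Nat.lt_succ_iff.1 (by exact_mod_cast h)
  intro j l hjl
  refine disjoint_left.2 fun a hj hl => hjl (Fin.ext ?_)
  exact le_antisymm (key j l a hj hl) (key l j a hl hj)

lemma cubeMeasure_slab {d N : ℕ} (k : Fin d) (j : Fin N) :
    (cubeMeasure d).real (slab N k j) = 1 / N := by
  have hN : (0 : ℝ) < N := by exact_mod_cast j.pos
  have hj : (j : ℝ) + 1 ≤ N := by exact_mod_cast j.isLt
  rw [Measure.real, cubeMeasure, Measure.restrict_apply' (measurableSet_unitCube d), slab,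
    unitCube, ← pi_inter_distrib, volume_pi_pi, Finset.prod_eq_single k]
  · have hsub : Ico ((j : ℝ) / N) (((j : ℝ) + 1) / N) ⊆ Icc 0 1 :=
      Ico_subset_Icc_self.trans (Icc_subset_Icc (by positivity) ((div_le_one hN).2 hj))
    rw [Function.update_self, inter_eq_self_of_subset_left hsub, Real.volume_Ico,
      ENNReal.toReal_ofReal] <;> ring_nf
    positivity
  · intro l _ hl
    simp [Function.update_of_ne hl]
  · simp

lemma integral_dispersion_ge_log {d n : ℕ} (hd : 1 ≤ d) (hn : d < n) :
    Real.log n / (9 * n) ≤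
      ∫ x, dispersion x ∂(Measure.pi fun _ : Fin n => cubeMeasure d) := by
  set ν := Measure.pi fun _ : Fin n => cubeMeasure d
  have hn1 : (1 : ℝ) < n := by exact_mod_cast (by omega : 1 < n)
  have hn0 : (0 : ℝ) < n := by linarith
  set L := Real.log n with hL
  have hL0 : 0 < L := Real.log_pos hn1
  have hLn : L ≤ n - 1 := Real.log_le_sub_one_of_pos hn0
  -- There are M + 1 slabs, so that 1 - 1/(M+1) = 1/(1 + 1/M) ≥ e^(-1/M). Since n/M ≤ L/2, a slab is
  -- missed with probability at least n^(-1/2), while M + 1 ≥ √n; hence m ≥ 1.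
  set M : ℕ := ⌈2 * n / L⌉₊ with hM
  have hM1 : 2 * n / L ≤ M := Nat.le_ceil _
  have hM2 : (M : ℝ) < 2 * n / L + 1 := Nat.ceil_lt_add_one (by positivity)
  have hM0 : (0 : ℝ) < M := lt_of_lt_of_le (by positivity) hM1
  let k : Fin d := ⟨0, hd⟩
  set m : ℝ := ((M + 1 : ℕ) : ℝ) * (1 - 1 / ((M + 1 : ℕ) : ℝ)) ^ n with hm
  have hbase : 1 - 1 / ((M + 1 : ℕ) : ℝ) = ((M : ℝ)⁻¹ + 1)⁻¹ := by
    push_cast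
    field_simp
    ring
  have hm1 : 1 ≤ m := by
    have hpow : (Real.sqrt n)⁻¹ ≤ (1 - 1 / ((M + 1 : ℕ) : ℝ)) ^ n := by
      rw [hbase, inv_pow]
      refine inv_anti₀ (by positivity) ?_
      calc ((M : ℝ)⁻¹ + 1) ^ n ≤ Real.exp ((M : ℝ)⁻¹) ^ n := by
            gcongr
            exact Real.add_one_le_exp _
        _ = Real.exp (n / M) := by
            rw [← Real.exp_nat_mul, div_eq_mul_inv]
        _ ≤ Real.exp (L / 2) := by
            refine Real.exp_le_exp.2 ?_
            rw [div_le_iff₀ hL0] at hM1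
            rw [div_le_div_iff₀ hM0 two_pos]
            linarith
        _ = Real.sqrt n := by
            rw [← Real.log_sqrt hn0.le, Real.exp_log (Real.sqrt_pos.2 hn0)]
    have hsq : Real.sqrt n ≤ (M + 1 : ℕ) := by
      have h1 : L = 2 * Real.log (Real.sqrt n) := by
        rw [Real.log_sqrt hn0.le]
        ring
      have h2 := Real.log_le_sub_one_of_pos (Real.sqrt_pos.2 hn0)
      have h3 := Real.sq_sqrt hn0.le
      have h4 := Real.sqrt_pos.2 hn0
      have h5 : Real.sqrt n ≤ 2 * n / L := by
        rw [le_div_iff₀ hL0]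
        nlinarith
      push_cast
      linarith
    calc (1 : ℝ) = Real.sqrt n * (Real.sqrt n)⁻¹ :=
          (mul_inv_cancel₀ (Real.sqrt_pos.2 hn0).ne').symm
      _ ≤ m := by
          rw [hm]
          gcongr
  have hprob := le_measureReal_exists_missed (ι := Fin n) (cubeMeasure d)
    (measurableSet_slab (N := M + 1) k) (pairwise_disjoint_slab k) (cubeMeasure_slab k)
    (m := m) (by simp [hm]) (by linarith)
  have hhalf : 1 / 2 ≤ m / (1 + m) := by
    rw [div_le_div_iff₀ two_pos (by linarith)]
    linarith
  set A : Set (Fin n → Fin d → ℝ) := {x | ∃ j : Fin (M + 1), ∀ i, x i ∉ slab (M + 1) k j} with hA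
  have hAm : MeasurableSet A := measurableSet_exists_missed (measurableSet_slab k)
  have hmono := integral_dispersion_ge_of_le ν
    (g := A.indicator fun _ => 1 / ((M + 1 : ℕ) : ℝ))
    (fun x => indicator_nonneg (fun _ _ => by positivity) x) (ae_of_all _ fun x => by
      by_cases hx : x ∈ A
      · rw [indicator_of_mem hx]
        obtain ⟨j, hj⟩ := hx
        rw [← cubeMeasure_slab k j]
        exact measureReal_pi_le_dispersion (ordConnected_slab_side k j) hj
      · rw [indicator_of_notMem hx]
        exact dispersion_nonneg x)
  rw [integral_indicator_const _ hAm, smul_eq_mul] at hmono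
  refine le_trans ?_ hmono
  -- Here (M + 1)L < 2n + 2L, and L ≤ n - 1. The constant 9 is twice 9/2, the 2 coming from the
  -- probability 1/2.
  have hNL : ((M + 1 : ℕ) : ℝ) * L ≤ 9 / 2 * n := by
    have h1 : (M : ℝ) * L < (2 * n / L + 1) * L := mul_lt_mul_of_pos_right hM2 hL0
    have h2 : (2 * n / L + 1) * L = 2 * n + L := by field_simp
    push_cast
    linarith
  calc L / (9 * n) ≤ 1 / 2 * (1 / ((M + 1 : ℕ) : ℝ)) := by
        rw [← mul_div_assoc, mul_one, div_div,
          div_le_div_iff₀ (by positivity) (by positivity)]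
        linarith
    _ ≤ ν.real A * (1 / ((M + 1 : ℕ) : ℝ)) := by
        gcongr
        exact hhalf.trans hprob

/-! ### Transfer from the product measure to the random variables. -/

theorem theorem1 {Ω : Type*} [MeasurableSpace Ω] (P : MeasureTheory.Measure Ω)
    [MeasureTheory.IsProbabilityMeasure P] (d n : ℕ) (hd : 1 ≤ d) (hn : d < n)
    (X : Fin n → Ω → (Fin d → ℝ)) (hmeas : ∀ i, Measurable (X i))
    (hindep : ProbabilityTheory.iIndepFun X P)
    (hunif : ∀ i, MeasureTheory.pdf.IsUniform (X i)
      (Set.univ.pi fun _ : Fin d => Set.Icc (0 : ℝ) 1) P MeasureTheory.volume) :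
    MeasureTheory.Integrable (fun ω => dispersion fun i => X i ω) P ∧
    max (Real.log n / (9 * n)) (d / (2 * Real.exp 1 * n))
      ≤ ∫ ω, dispersion (fun i => X i ω) ∂P ∧
    ∫ ω, dispersion (fun i => X i ω) ∂P
      ≤ 9 * d / n * Real.log (Real.exp 1 * n / d) := by
  have hlaw : ∀ i, P.map (X i) = cubeMeasure d := fun i => by
    rw [show P.map (X i) = ProbabilityTheory.cond volume (unitCube d) from hunif i,
      ProbabilityTheory.cond, volume_unitCube, inv_one, one_smul, cubeMeasure]
  have hXm : Measurable fun ω i => X i ω := measurable_pi_lambda _ hmeas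
  have hjoint : P.map (fun ω i => X i ω) = Measure.pi fun _ : Fin n => cubeMeasure d := by
    rw [(ProbabilityTheory.iIndepFun_iff_map_fun_eq_pi_map fun i =>
      (hmeas i).aemeasurable).1 hindep]
    simp_rw [hlaw]
  have hint : ∫ ω, dispersion (fun i => X i ω) ∂P =
      ∫ x, dispersion x ∂(Measure.pi fun _ : Fin n => cubeMeasure d) := by
    rw [← hjoint, integral_map hXm.aemeasurable measurable_dispersion.aestronglyMeasurable]
  refine ⟨?_, ?_, ?_⟩
  · have h := integrable_dispersion (Measure.pi fun _ : Fin n => cubeMeasure d)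
    rw [← hjoint] at h
    exact h.comp_measurable hXm
  · rw [hint]
    exact max_le (integral_dispersion_ge_log hd hn) (integral_dispersion_ge_dim hd hn)
  · rw [hint]
    exact integral_dispersion_le hd hn
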